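/- Let $\mathfrak{S}_n(2413,3142)$ be the set of permutations $\pi=\pi(1)\cdots\pi(n)$ of $\{1,\dots,n\}$ that avoid both patterns $2413$ and $3142$ (no subsequence of $\pi$ is order isomorphic to either of them). Let $\mathsf{des}\,\pi=\#\{1\le i\le n-1:\pi(i)>\pi(i+1)\}$ be the number of descents of $\pi$, and put $$S_n(t)=\sum_{\pi\in\mathfrak{S}_n(2413,3142)}t^{\mathsf{des}\,\pi}.$$ For $m\ge 0$ let $r_m$ be the number of permutations $\pi\in\mathfrak{S}_{2m+1}(2413,3142)$ that are alternating, i.e. $\pi(1)<\pi(2)>\pi(3)<\pi(4)>\cdots$. Then for every $n\ge 1$, $$S_n(-1)=\sum_{\pi\in\mathfrak{S}_n(2413,3142)}(-1)^{\mathsf{des}\,\pi}=\begin{cases}0 & \text{if } n \text{ is even},\\ (-1)^{\frac{n-1}{2}}\,r_{\frac{n-1}{2}} & \text{if } n \text{ is odd}.\end{cases}$$ -/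

import Mathlib

namespace PermPattern

/-- The permutation `π` (in one-line notation `π 0, π 1, …, π (n - 1)`) contains the pattern `τ`,
given by its one-line notation: some subsequence of `π` is order isomorphic to `τ`. -/
def Contains {n k : ℕ} (π : Equiv.Perm (Fin n)) (τ : Fin k → ℕ) : Prop :=
  ∃ f : Fin k → Fin n, (∀ i j : Fin k, i < j → f i < f j) ∧
    ∀ i j : Fin k, π (f i) < π (f j) ↔ τ i < τ j

instance {n k : ℕ} (π : Equiv.Perm (Fin n)) (τ : Fin k → ℕ) : Decidable (Contains π τ) := by
  unfold Contains
  infer_instance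

/-- The set `𝔖ₙ(2413, 3142)` of permutations of length `n` that avoid both `2413` and `3142`. -/
def avoiders (n : ℕ) : Finset (Equiv.Perm (Fin n)) :=
  {π | ¬ Contains π ![2, 4, 1, 3] ∧ ¬ Contains π ![3, 1, 4, 2]}

/-- The number of descents of `π`: positions `i` with a next position, such that
`π i > π (i + 1)`. -/
def des {n : ℕ} (π : Equiv.Perm (Fin n)) : ℕ :=
  Finset.card {i : Fin n | ∃ j : Fin n, (j : ℕ) = (i : ℕ) + 1 ∧ π j < π i}

/-- `π` is alternating (up-down): `π 0 < π 1 > π 2 < π 3 > ⋯`. -/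
def IsAlternating {n : ℕ} (π : Equiv.Perm (Fin n)) : Prop :=
  ∀ i j : Fin n, (j : ℕ) = (i : ℕ) + 1 →
    (Even (i : ℕ) → π i < π j) ∧ (Odd (i : ℕ) → π j < π i)

instance {n : ℕ} (π : Equiv.Perm (Fin n)) : Decidable (IsAlternating π) := by
  unfold IsAlternating
  infer_instance

/-- The set `𝔄ₙ(2413, 3142)` of alternating permutations of length `n` that avoid both `2413`
and `3142`. -/
def alternatingAvoiders (n : ℕ) : Finset (Equiv.Perm (Fin n)) :=
  {π ∈ avoiders n | IsAlternating π}

/-- `r m` is the number of alternating permutations of length `2 m + 1` that avoid both `2413`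
and `3142`. -/
def r (m : ℕ) : ℕ := (alternatingAvoiders (2 * m + 1)).card

/-- The descent polynomial `Sₙ(t) = ∑ t ^ des π`, over `π` in `𝔖ₙ(2413, 3142)`. -/
noncomputable def S (n : ℕ) : Polynomial ℤ :=
  ∑ π ∈ avoiders n, (Polynomial.X : Polynomial ℤ) ^ des π

end PermPattern

/-! A permutation of length at least 2 avoiding 2413 and 3142 is exactly one of a direct sum and a
skew sum (`Separable.decomposable_or`, `Decomposable.not_toDual`), and complementation swaps the two
kinds. Cutting a direct sum at its least cut gives an indecomposable block, an ascent, and an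
arbitrary avoider.

Weight an avoider by the ordered product of `U` over ascents and `D` over descents, in a ring that
need not be commutative. With P, A, B the generating series of `total U D`, `totalDecomposable U D`
and `totalDecomposable D U`, this gives P = X + A + B, A = (X + B) U P, B = (X + A) D P (`total_eq`,
`totalDecomposable_eq`, `totalDecomposable_swap_eq`).

The system is specialised twice. Taking `U = 1`, `D = -1` gives the signed sums and P = X - XP² -
P³. Taking the matrix units `up`, `down`, the (0,0) entry R selects alternating permutations of odd
length, and R = X + XR² + R³. Substituting iX for X turns the first cubic into the second, and the
second has only one solution without constant term, so -i P(iX) = R. Comparing coefficients gives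
the theorem. -/

namespace PermPattern

/-! ### Separable sequences are direct sums or skew sums. -/

section Sequences

variable {α β : Type*} [LinearOrder α] [LinearOrder β]

/-- The first `n` terms of `v` avoid the patterns `2413` and `3142`. -/
def Separable (n : ℕ) (v : ℕ → α) : Prop :=
  ∀ a b c d, a < b → b < c → c < d → d < n →
    ¬ (v c < v a ∧ v a < v d ∧ v d < v b) ∧ ¬ (v b < v d ∧ v d < v a ∧ v a < v c)

/-- Among the first `n` terms of `v`, the first `k` are smaller than all the others. -/
def IsCut (n : ℕ) (v : ℕ → α) (k : ℕ) : Prop :=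
  0 < k ∧ k < n ∧ ∀ i j, i < k → k ≤ j → j < n → v i < v j

/-- The first `n` terms of `v` split as a direct sum. -/
def Decomposable (n : ℕ) (v : ℕ → α) : Prop := ∃ k, IsCut n v k

/-- The ordered product of `U` over the ascents and `D` over the descents of the first `n`
terms of `v`. -/
def weight {M : Type*} [Monoid M] (U D : M) (n : ℕ) (v : ℕ → α) : M :=
  ((List.range (n - 1)).map fun i => if v i < v (i + 1) then U else D).prod

/-- The first `n` terms of `v` and of `w` are order isomorphic. -/
def OrderIsomorphic (n : ℕ) (v : ℕ → α) (w : ℕ → β) : Prop :=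
  ∀ i j, i < n → j < n → (v i < v j ↔ w i < w j)

theorem OrderIsomorphic.separable_iff {n : ℕ} {v : ℕ → α} {w : ℕ → β}
    (h : OrderIsomorphic n v w) : Separable n v ↔ Separable n w := by
  unfold Separable
  refine forall₄_congr fun a b c d => ?_
  refine forall₄_congr fun h1 h2 h3 h4 => ?_
  rw [h c a (by omega) (by omega), h a d (by omega) (by omega), h d b (by omega) (by omega),
    h b d (by omega) (by omega), h d a (by omega) (by omega), h a c (by omega) (by omega)]

theorem OrderIsomorphic.isCut_iff {n : ℕ} {v : ℕ → α} {w : ℕ → β}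
    (h : OrderIsomorphic n v w) (k : ℕ) : IsCut n v k ↔ IsCut n w k := by
  unfold IsCut
  refine and_congr_right fun h0 => and_congr_right fun h1 => ?_
  refine forall₂_congr fun i j => forall₃_congr fun h2 h3 h4 => ?_
  exact h i j (by omega) h4

theorem OrderIsomorphic.decomposable_iff {n : ℕ} {v : ℕ → α} {w : ℕ → β}
    (h : OrderIsomorphic n v w) : Decomposable n v ↔ Decomposable n w :=
  exists_congr h.isCut_iff

theorem OrderIsomorphic.weight_eq {M : Type*} [Monoid M] (U D : M) {n : ℕ} {v : ℕ → α}
    {w : ℕ → β} (h : OrderIsomorphic n v w) : weight U D n v = weight U D n w := by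
  unfold weight
  congr 1
  refine List.map_congr_left fun i hi => ?_
  rw [List.mem_range] at hi
  simp only [h i (i + 1) (by omega) (by omega)]

/-- 2413 and 3142 are complements of each other. -/
theorem separable_toDual_iff {n : ℕ} {v : ℕ → α} :
    Separable n (fun i => OrderDual.toDual (v i)) ↔ Separable n v := by
  unfold Separable
  simp only [OrderDual.toDual_lt_toDual]
  refine forall₄_congr fun a b c d => forall₄_congr fun h1 h2 h3 h4 => ?_
  tauto

/-- Injectivity is essential: `weight` counts a tie as `D` in either order. -/
theorem weight_toDual {M : Type*} [Monoid M] (U D : M) {n : ℕ} {v : ℕ → α}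
    (hv : Set.InjOn v (Set.Iio n)) :
    weight U D n (fun i => OrderDual.toDual (v i)) = weight D U n v := by
  unfold weight
  congr 1
  refine List.map_congr_left fun i hi => ?_
  rw [List.mem_range] at hi
  have hne : v i ≠ v (i + 1) := fun h => by
    have := hv (Set.mem_Iio.2 (by omega)) (Set.mem_Iio.2 (by omega)) h
    omega
  simp only [OrderDual.toDual_lt_toDual]
  rcases lt_or_gt_of_ne hne with h | h
  · rw [if_neg h.not_gt, if_pos h]
  · rw [if_pos h, if_neg h.not_gt]

theorem Separable.mono {m n : ℕ} {v : ℕ → α} (hv : Separable n v) (h : m ≤ n) :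
    Separable m v :=
  fun a b c d h1 h2 h3 h4 => hv a b c d h1 h2 h3 (h4.trans_le h)

/-- Appending a term to a decomposable sequence, without creating `2413` or `3142`. -/
theorem Decomposable.succ {n : ℕ} {v : ℕ → α} (hv : Set.InjOn v (Set.Iio (n + 1)))
    (hs : Separable (n + 1) v) (hd : Decomposable n v) :
    Decomposable (n + 1) v ∨ Decomposable (n + 1) fun i => OrderDual.toDual (v i) := by
  obtain ⟨k, hk0, hkn, hk⟩ := hd
  have hne : ∀ i, i < n → v i ≠ v n := fun i hi h => by
    have := hv (Set.mem_Iio.2 (by omega)) (Set.mem_Iio.2 (by omega)) h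
    omega
  by_cases h1 : ∀ i, i < k → v i < v n
  · refine Or.inl ⟨k, hk0, by omega, fun i j hi hj hjn => ?_⟩
    rcases Nat.lt_succ_iff_lt_or_eq.1 hjn with h | rfl
    · exact hk i j hi hj h
    · exact h1 i hi
  by_cases h2 : ∀ i, i < n → v n < v i
  · refine Or.inr ⟨n, by omega, by omega, fun i j hi hj hjn => ?_⟩
    obtain rfl : j = n := by omega
    exact h2 i hi
  push Not at h1 h2
  obtain ⟨a, hak, ha⟩ := h1
  obtain ⟨b, hbn, hb⟩ := h2
  have ha' : v n < v a := lt_of_le_of_ne ha (hne a (by omega)).symm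
  have hb' : v b < v n := lt_of_le_of_ne hb (hne b hbn)
  have hex : ∃ i, v n < v i := ⟨a, ha'⟩
  classical
  -- The new term is neither above the lower block nor a new minimum. The cut moves to the first
  -- position `m` whose value exceeds `v n`.
  obtain ⟨m, hm, hmin⟩ : ∃ m, v n < v m ∧ ∀ i, v n < v i → m ≤ i :=
    ⟨Nat.find hex, Nat.find_spec hex, fun i hi => Nat.find_min' hex hi⟩
  have hma : m ≤ a := hmin a ha'
  have hlow : ∀ j, m ≤ j → j < n → v n < v j := fun j hmj hjn => by
    by_cases hjk : j < k
    · by_contra hj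
      have hj' : v j < v n := lt_of_le_of_ne (not_lt.1 hj) (hne j hjn)
      have hmj' : m < j := lt_of_le_of_ne hmj (by rintro rfl; exact hj hm)
      -- A smaller value at `j` would make `m, j, k, n` an occurrence of 3142.
      exact (hs m j k n hmj' hjk hkn (by omega)).2 ⟨hj', hm, hk m k (by omega) le_rfl hkn⟩
    · exact ha'.trans (hk a j hak (by omega) hjn)
  have hbm : b < m := by
    by_contra h
    exact hb'.not_gt (hlow b (by omega) hbn)
  refine Or.inl ⟨m, by omega, by omega, fun i j hi hj hjn => ?_⟩
  have hi' : v i < v n := lt_of_le_of_ne (not_lt.1 fun h => by have := hmin i h; omega)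
    (hne i (by omega))
  rcases Nat.lt_succ_iff_lt_or_eq.1 hjn with h | rfl
  · exact hi'.trans (hlow j hj h)
  · exact hi'

/-- A sequence avoiding `2413` and `3142` is a direct sum or a skew sum. -/
theorem Separable.decomposable_or {n : ℕ} (hn : 2 ≤ n) {v : ℕ → α}
    (hv : Set.InjOn v (Set.Iio n)) (hs : Separable n v) :
    Decomposable n v ∨ Decomposable n fun i => OrderDual.toDual (v i) := by
  induction n, hn using Nat.le_induction with
  | base =>
    have hne : v 0 ≠ v 1 := fun h => by
      have := hv (Set.mem_Iio.2 (by omega)) (Set.mem_Iio.2 (by omega)) h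
      omega
    rcases lt_or_gt_of_ne hne with h | h
    · refine Or.inl ⟨1, by omega, by omega, fun i j hi hj hjn => ?_⟩
      obtain rfl : i = 0 := by omega
      obtain rfl : j = 1 := by omega
      exact h
    · refine Or.inr ⟨1, by omega, by omega, fun i j hi hj hjn => ?_⟩
      obtain rfl : i = 0 := by omega
      obtain rfl : j = 1 := by omega
      exact h
  | succ n hn ih =>
    rcases ih (hv.mono (Set.Iio_subset_Iio n.le_succ)) (hs.mono n.le_succ) with h | h
    · exact h.succ hv hs
    · exact (Decomposable.succ (v := fun i => OrderDual.toDual (v i)) hv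
        (separable_toDual_iff.2 hs) h).symm

/-- A direct sum has its first term below its last; a skew sum has it above. -/
theorem Decomposable.not_toDual {n : ℕ} {v : ℕ → α} (h : Decomposable n v) :
    ¬ Decomposable n fun i => OrderDual.toDual (v i) := by
  rintro ⟨l, hl0, hln, hl⟩
  obtain ⟨k, hk0, hkn, hk⟩ := h
  exact (hk 0 (n - 1) hk0 (by omega) (by omega)).not_gt
    (hl 0 (n - 1) hl0 (by omega) (by omega))

theorem Decomposable.two_le {n : ℕ} {v : ℕ → α} (h : Decomposable n v) : 2 ≤ n := by
  obtain ⟨k, hk0, hkn, -⟩ := h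
  omega

end Sequences

end PermPattern

namespace PermPattern

/-! ### Behaviour of avoidance and weight at a cut. -/

section Cut

variable {α : Type*} [LinearOrder α]

/-- Neither 2413 nor 3142 is a direct sum, so no occurrence can straddle a cut. -/
theorem IsCut.separable_iff {k l : ℕ} {v : ℕ → α} (h : IsCut (k + l) v k) :
    Separable (k + l) v ↔ Separable k v ∧ Separable l fun i => v (k + i) := by
  refine ⟨fun hs => ⟨hs.mono (by omega), fun a b c d h1 h2 h3 h4 =>
    hs (k + a) (k + b) (k + c) (k + d) (by omega) (by omega) (by omega) (by omega)⟩, ?_⟩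
  rintro ⟨hl, hr⟩ a b c d h1 h2 h3 h4
  obtain ⟨-, -, hk⟩ := h
  by_cases hd : d < k
  · exact hl a b c d h1 h2 h3 hd
  by_cases ha : a < k
  · refine ⟨fun ⟨p, q, s⟩ => ?_, fun ⟨p, q, s⟩ => (hk a d ha (by omega) h4).not_gt q⟩
    by_cases hb : b < k
    · exact (hk b d hb (by omega) h4).not_gt s
    · exact (hk a c ha (by omega) (by omega)).not_gt p
  · have := hr (a - k) (b - k) (c - k) (d - k) (by omega) (by omega) (by omega) (by omega)
    simpa only [Nat.add_sub_cancel' (show k ≤ a by omega),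
      Nat.add_sub_cancel' (show k ≤ b by omega), Nat.add_sub_cancel' (show k ≤ c by omega),
      Nat.add_sub_cancel' (show k ≤ d by omega)] using this

/-- The step across the cut is an ascent, whence the middle factor `U`. -/
theorem IsCut.weight_eq {M : Type*} [Monoid M] (U D : M) {k l : ℕ} {v : ℕ → α}
    (h : IsCut (k + l) v k) :
    weight U D (k + l) v = weight U D k v * U * weight U D l fun i => v (k + i) := by
  obtain ⟨hk0, hkl, hk⟩ := h
  obtain ⟨k, rfl⟩ : ∃ k', k = k' + 1 := ⟨k - 1, by omega⟩
  obtain ⟨l, rfl⟩ : ∃ l', l = l' + 1 := ⟨l - 1, by omega⟩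
  unfold weight
  rw [show k + 1 + (l + 1) - 1 = k + 1 + l by omega, List.range_add, List.range_succ]
  simp only [List.map_append, List.prod_append, List.map_map, List.map_cons, List.map_nil,
    List.prod_singleton, Nat.add_sub_cancel]
  rw [if_pos (hk k (k + 1) (by omega) le_rfl (by omega))]
  rfl

/-- The cuts of the whole sequence before `k` are exactly the cuts of its first `k` terms. -/
theorem IsCut.forall_le_iff {n k : ℕ} {v : ℕ → α} (h : IsCut n v k) :
    (∀ j, IsCut n v j → k ≤ j) ↔ ¬ Decomposable k v := by
  obtain ⟨hk0, hkn, hk⟩ := h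
  constructor
  · rintro hmin ⟨j, hj0, hjk, hj⟩
    have := hmin j ⟨hj0, by omega, fun a b ha hb hbn => ?_⟩
    · omega
    · by_cases hbk : b < k
      · exact hj a b ha hb hbk
      · exact hk a b (by omega) (by omega) hbn
  · rintro hd j ⟨hj0, hjn, hj⟩
    by_contra hjk
    exact hd ⟨j, hj0, by omega, fun a b ha hb hbk => hj a b ha hb (by omega)⟩

end Cut

/-! ### Direct sums and complements of permutations. -/

section Perm

open Equiv

/-- The one-line notation of a permutation, extended by zeros. -/
def seq {n : ℕ} (π : Perm (Fin n)) (i : ℕ) : ℕ := if h : i < n then π ⟨i, h⟩ else 0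

theorem seq_of_lt {n : ℕ} (π : Perm (Fin n)) {i : ℕ} (h : i < n) : seq π i = π ⟨i, h⟩ :=
  dif_pos h

theorem seq_val {n : ℕ} (π : Perm (Fin n)) (i : Fin n) : seq π i = π i := seq_of_lt π i.2

theorem seq_lt {n : ℕ} (π : Perm (Fin n)) {i : ℕ} (h : i < n) : seq π i < n := by
  rw [seq_of_lt π h]
  exact Fin.is_lt _

theorem seq_injOn {n : ℕ} (π : Perm (Fin n)) : Set.InjOn (seq π) (Set.Iio n) := by
  intro i hi j hj h
  rw [seq_of_lt π hi, seq_of_lt π hj, Fin.val_inj, π.injective.eq_iff] at h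
  exact congrArg Fin.val h

theorem perm_ext_seq {n : ℕ} {π ρ : Perm (Fin n)} (h : ∀ i, i < n → seq π i = seq ρ i) :
    π = ρ := by
  ext i
  rw [← seq_val, ← seq_val, h i i.2]

theorem contains_four_iff {n : ℕ} (π : Perm (Fin n)) (τ : Fin 4 → ℕ) :
    Contains π τ ↔ ∃ a b c d, a < b ∧ b < c ∧ c < d ∧ d < n ∧
      ∀ i j : Fin 4, seq π (![a, b, c, d] i) < seq π (![a, b, c, d] j) ↔ τ i < τ j := by
  constructor
  · rintro ⟨f, hf, h⟩
    refine ⟨f 0, f 1, f 2, f 3, hf 0 1 (by decide), hf 1 2 (by decide), hf 2 3 (by decide),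
      (f 3).2, fun i j => ?_⟩
    have key : ∀ i : Fin 4, (![(f 0 : ℕ), f 1, f 2, f 3] i) = f i := by
      intro i; fin_cases i <;> rfl
    rw [key, key, seq_val, seq_val, ← h, Fin.lt_def]
  · rintro ⟨a, b, c, d, h1, h2, h3, h4, h⟩
    refine ⟨![⟨a, by omega⟩, ⟨b, by omega⟩, ⟨c, by omega⟩, ⟨d, by omega⟩], ?_, fun i j => ?_⟩
    · intro i j hij
      fin_cases i <;> fin_cases j <;> simp at hij ⊢ <;> omega
    · rw [← h, Fin.lt_def, ← seq_val, ← seq_val]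
      fin_cases i <;> fin_cases j <;> rfl

theorem mem_avoiders_iff {n : ℕ} (π : Perm (Fin n)) :
    π ∈ avoiders n ↔ Separable n (seq π) := by
  simp only [avoiders, Finset.mem_filter_univ, contains_four_iff]
  constructor
  · rintro ⟨h1, h2⟩ a b c d hab hbc hcd hd
    refine ⟨fun ⟨p, q, s⟩ => h1 ⟨a, b, c, d, hab, hbc, hcd, hd, fun i j => ?_⟩,
      fun ⟨p, q, s⟩ => h2 ⟨a, b, c, d, hab, hbc, hcd, hd, fun i j => ?_⟩⟩
    all_goals
      fin_cases i <;> fin_cases j <;> simp <;> omega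
  · intro h
    constructor
    · rintro ⟨a, b, c, d, hab, hbc, hcd, hd, hv⟩
      exact (h a b c d hab hbc hcd hd).1
        ⟨(hv 2 0).2 (by decide), (hv 0 3).2 (by decide), (hv 3 1).2 (by decide)⟩
    · rintro ⟨a, b, c, d, hab, hbc, hcd, hd, hv⟩
      exact (h a b c d hab hbc hcd hd).2
        ⟨(hv 1 3).2 (by decide), (hv 3 0).2 (by decide), (hv 0 2).2 (by decide)⟩

/-- The direct sum of two permutations. -/
def directSum {k l : ℕ} (α : Perm (Fin k)) (β : Perm (Fin l)) : Perm (Fin (k + l)) :=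
  finSumFinEquiv.permCongr (Equiv.sumCongr α β)

theorem seq_directSum_left {k l : ℕ} (α : Perm (Fin k)) (β : Perm (Fin l)) {i : ℕ}
    (h : i < k) : seq (directSum α β) i = seq α i := by
  have : (⟨i, by omega⟩ : Fin (k + l)) = Fin.castAdd l ⟨i, h⟩ := rfl
  rw [seq_of_lt _ (by omega), seq_of_lt _ h, this, directSum, Equiv.permCongr_apply,
    finSumFinEquiv_symm_apply_castAdd]
  rfl

theorem seq_directSum_right {k l : ℕ} (α : Perm (Fin k)) (β : Perm (Fin l)) {i : ℕ}
    (h : i < l) : seq (directSum α β) (k + i) = k + seq β i := by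
  have : (⟨k + i, by omega⟩ : Fin (k + l)) = Fin.natAdd k ⟨i, h⟩ := rfl
  rw [seq_of_lt _ (by omega), seq_of_lt _ h, this, directSum, Equiv.permCongr_apply,
    finSumFinEquiv_symm_apply_natAdd]
  rfl

theorem orderIsomorphic_directSum_left {k l : ℕ} (α : Perm (Fin k)) (β : Perm (Fin l)) :
    OrderIsomorphic k (seq (directSum α β)) (seq α) := fun i j hi hj => by
  rw [seq_directSum_left _ _ hi, seq_directSum_left _ _ hj]

theorem orderIsomorphic_directSum_right {k l : ℕ} (α : Perm (Fin k)) (β : Perm (Fin l)) :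
    OrderIsomorphic l (fun i => seq (directSum α β) (k + i)) (seq β) := fun i j hi hj => by
  simp only [seq_directSum_right _ _ hi, seq_directSum_right _ _ hj, Nat.add_lt_add_iff_left]

theorem isCut_directSum {k l : ℕ} (hk : 0 < k) (hl : 0 < l) (α : Perm (Fin k))
    (β : Perm (Fin l)) : IsCut (k + l) (seq (directSum α β)) k := by
  refine ⟨hk, by omega, fun i j hi hj hjn => ?_⟩
  obtain ⟨j, rfl⟩ := Nat.exists_eq_add_of_le hj
  rw [seq_directSum_left _ _ hi, seq_directSum_right _ _ (show j < l by omega)]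
  have := seq_lt α hi
  omega

theorem directSum_injective {k l : ℕ} :
    Function.Injective fun p : Perm (Fin k) × Perm (Fin l) => directSum p.1 p.2 := by
  rintro ⟨α, β⟩ ⟨α', β'⟩ h
  have h' : directSum α β = directSum α' β' := h
  refine Prod.ext (perm_ext_seq fun i hi => ?_) (perm_ext_seq fun i hi => ?_)
  · rw [← seq_directSum_left α β hi, h', seq_directSum_left _ _ hi]
  · have := seq_directSum_right α β hi
    rw [h', seq_directSum_right _ _ hi] at this
    dsimp only
    omega

/-- The `n - k` values at positions from `k` on all exceed the value at `i`, which leaves it fewer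
than `k` possibilities. -/
theorem IsCut.seq_lt {n k : ℕ} {π : Perm (Fin n)} (h : IsCut n (seq π) k) {i : ℕ}
    (hi : i < k) : seq π i < k := by
  obtain ⟨hk0, hkn, hk⟩ := h
  have hsub : ((Finset.univ.filter fun j : Fin n => k ≤ (j : ℕ)).image π) ⊆
      Finset.Ioi (π ⟨i, by omega⟩) := by
    intro x hx
    obtain ⟨j, hj, rfl⟩ := Finset.mem_image.1 hx
    rw [Finset.mem_Ioi, Fin.lt_def, ← seq_val, ← seq_val]
    exact hk i j hi (Finset.mem_filter.1 hj).2 j.2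
  have hcard := Finset.card_le_card hsub
  rw [Finset.card_image_of_injective _ π.injective, Fin.card_Ioi, ← seq_val] at hcard
  have : (Finset.univ.filter fun j : Fin n => k ≤ (j : ℕ)) = Finset.Ici ⟨k, hkn⟩ := by
    ext j
    simp [Fin.le_def]
  rw [this, Fin.card_Ici] at hcard
  have h' := PermPattern.seq_lt π (show i < n by omega)
  simp only at hcard
  omega

/-- By `IsCut.seq_lt`, `π` maps the left block into itself, so it is a sum of permutations of the
two blocks. -/
theorem IsCut.exists_directSum {k l : ℕ} {π : Perm (Fin (k + l))}
    (h : IsCut (k + l) (seq π) k) :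
    ∃ (α : Perm (Fin k)) (β : Perm (Fin l)), directSum α β = π := by
  have hmaps : Set.MapsTo (finSumFinEquiv.symm.permCongr π)
      (Set.range (Sum.inl : Fin k → Fin k ⊕ Fin l)) (Set.range Sum.inl) := by
    rintro _ ⟨i, rfl⟩
    have hlt := h.seq_lt i.2
    rw [seq_of_lt _ (by omega)] at hlt
    refine ⟨⟨_, hlt⟩, ?_⟩
    rw [Equiv.permCongr_apply, Equiv.eq_symm_apply]
    rfl
  obtain ⟨⟨α, β⟩, hαβ⟩ := Perm.mem_sumCongrHom_range_of_perm_mapsTo_inl hmaps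
  refine ⟨α, β, ?_⟩
  have : Equiv.sumCongr α β = finSumFinEquiv.symm.permCongr π := hαβ
  rw [directSum, this]
  ext i
  simp

/-- The complement of a permutation. -/
def complement {n : ℕ} (π : Perm (Fin n)) : Perm (Fin n) := π.trans Fin.revPerm

theorem complement_complement {n : ℕ} (π : Perm (Fin n)) : complement (complement π) = π := by
  ext i
  simp [complement]

theorem orderIsomorphic_complement {n : ℕ} (π : Perm (Fin n)) :
    OrderIsomorphic n (seq (complement π)) fun i => OrderDual.toDual (seq π i) :=
  fun i j hi hj => by
    rw [OrderDual.toDual_lt_toDual, seq_of_lt _ hi, seq_of_lt _ hj, seq_of_lt _ hi,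
      seq_of_lt _ hj, ← Fin.lt_def, ← Fin.lt_def]
    exact Fin.rev_lt_rev

end Perm

end PermPattern

namespace PermPattern

/-! ### Recursions for the weighted totals. -/

section

open Equiv Finset

open scoped Classical in
/-- The avoiders of length `n` that are direct sums. -/
noncomputable def decomposables (n : ℕ) : Finset (Perm (Fin n)) :=
  {π ∈ avoiders n | Decomposable n (seq π)}

open scoped Classical in
/-- The avoiders of length `n` that are not direct sums. -/
noncomputable def indecomposables (n : ℕ) : Finset (Perm (Fin n)) :=
  {π ∈ avoiders n | ¬ Decomposable n (seq π)}

variable {M : Type*} [Ring M] (U D : M)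

/-- The total weight of the avoiders of length `n ≥ 1`. -/
noncomputable def total (n : ℕ) : M :=
  if n = 0 then 0 else ∑ π ∈ avoiders n, weight U D n (seq π)

/-- The total weight of the avoiders of length `n` that are direct sums. -/
noncomputable def totalDecomposable (n : ℕ) : M :=
  ∑ π ∈ decomposables n, weight U D n (seq π)

theorem mem_decomposables {n : ℕ} {π : Perm (Fin n)} :
    π ∈ decomposables n ↔ Separable n (seq π) ∧ Decomposable n (seq π) := by
  simp only [decomposables, mem_filter, mem_avoiders_iff]

theorem mem_indecomposables {n : ℕ} {π : Perm (Fin n)} :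
    π ∈ indecomposables n ↔ Separable n (seq π) ∧ ¬ Decomposable n (seq π) := by
  simp only [indecomposables, mem_filter, mem_avoiders_iff]

theorem decomposables_of_lt_two {n : ℕ} (h : n < 2) : decomposables n = ∅ := by
  refine eq_empty_of_forall_notMem fun π hπ => ?_
  have := (mem_decomposables.1 hπ).2.two_le
  omega

theorem totalDecomposable_add {n : ℕ} (hn : n ≠ 0) :
    totalDecomposable U D n + ∑ π ∈ indecomposables n, weight U D n (seq π) = total U D n := by
  rw [totalDecomposable, decomposables, indecomposables, sum_filter_add_sum_filter_not, total,
    if_neg hn]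

theorem weight_complement {n : ℕ} (π : Perm (Fin n)) :
    weight U D n (seq (complement π)) = weight D U n (seq π) := by
  rw [(orderIsomorphic_complement π).weight_eq, weight_toDual _ _ (seq_injOn π)]

theorem separable_complement {n : ℕ} (π : Perm (Fin n)) :
    Separable n (seq (complement π)) ↔ Separable n (seq π) := by
  rw [(orderIsomorphic_complement π).separable_iff, separable_toDual_iff]

theorem total_comm (n : ℕ) : total U D n = total D U n := by
  unfold total
  split_ifs
  · rfl
  refine sum_nbij' complement complement ?_ ?_ ?_ ?_ ?_
  · intro π hπ
    rwa [mem_avoiders_iff, separable_complement, ← mem_avoiders_iff]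
  · intro π hπ
    rwa [mem_avoiders_iff, separable_complement, ← mem_avoiders_iff]
  · exact fun π _ => complement_complement π
  · exact fun π _ => complement_complement π
  · exact fun π _ => (weight_complement D U π).symm

/-- From length 2 on, the indecomposable avoiders are the skew sums, which are the complements of
direct sums; complementing exchanges `U` and `D`. -/
theorem sum_indecomposables_of_two_le {n : ℕ} (hn : 2 ≤ n) :
    ∑ π ∈ indecomposables n, weight U D n (seq π) = totalDecomposable D U n := by
  refine sum_nbij' complement complement ?_ ?_ ?_ ?_ ?_
  · intro π hπ
    rw [mem_indecomposables] at hπ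
    rw [mem_decomposables, separable_complement,
      (orderIsomorphic_complement π).decomposable_iff]
    exact ⟨hπ.1, (hπ.1.decomposable_or hn (seq_injOn π)).resolve_left hπ.2⟩
  · intro π hπ
    rw [mem_decomposables] at hπ
    rw [mem_indecomposables, separable_complement,
      (orderIsomorphic_complement π).decomposable_iff]
    exact ⟨hπ.1, hπ.2.not_toDual⟩
  · exact fun π _ => complement_complement π
  · exact fun π _ => complement_complement π
  · exact fun π _ => (weight_complement D U π).symm

theorem sum_indecomposables_one :
    ∑ π ∈ indecomposables 1, weight U D 1 (seq π) = 1 := by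
  have : indecomposables 1 = {1} := by
    refine eq_singleton_iff_unique_mem.2 ⟨?_, fun π _ => Subsingleton.elim _ _⟩
    rw [mem_indecomposables]
    refine ⟨fun a b c d h1 h2 h3 h4 => by omega, fun h => ?_⟩
    have := h.two_le
    omega
  rw [this, sum_singleton]
  simp [weight]

theorem total_eq (n : ℕ) :
    total U D n = (if n = 1 then 1 else 0) + totalDecomposable U D n +
      totalDecomposable D U n := by
  rcases Nat.lt_or_ge n 2 with h | h
  · interval_cases n
    · simp [total, totalDecomposable, decomposables_of_lt_two]
    · rw [← totalDecomposable_add U D one_ne_zero, sum_indecomposables_one]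
      simp [totalDecomposable, decomposables_of_lt_two]
  · rw [← totalDecomposable_add U D (by omega), sum_indecomposables_of_two_le U D h,
      if_neg (by omega), zero_add]

theorem sum_indecomposables {n : ℕ} (hn : n ≠ 0) :
    ∑ π ∈ indecomposables n, weight U D n (seq π) =
      (if n = 1 then 1 else 0) + totalDecomposable D U n := by
  have h1 := totalDecomposable_add U D hn
  rw [total_eq, add_right_comm, add_comm] at h1
  exact add_right_cancel h1

/-- `directSum` is a bijection from pairs (indecomposable avoider, avoider) onto the avoiders with
least cut `k`. -/
theorem sum_leastCut {k l : ℕ} (hk : 0 < k) (hl : 0 < l) (s : Finset (Perm (Fin (k + l))))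
    (hs : ∀ π, π ∈ s ↔ Separable (k + l) (seq π) ∧ IsCut (k + l) (seq π) k ∧
      ∀ j, IsCut (k + l) (seq π) j → k ≤ j) :
    ∑ π ∈ s, weight U D (k + l) (seq π) =
      ((if k = 1 then 1 else 0) + totalDecomposable D U k) * U * total U D l := by
  rw [← sum_indecomposables U D hk.ne', total, if_neg hl.ne', sum_mul, sum_mul_sum,
    ← sum_product']
  symm
  have hmem : ∀ (α : Perm (Fin k)) (β : Perm (Fin l)), directSum α β ∈ s ↔
      α ∈ indecomposables k ∧ β ∈ avoiders l := by
    intro α β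
    have hc := isCut_directSum hk hl α β
    rw [hs, hc.separable_iff, and_iff_right hc, hc.forall_le_iff,
      (orderIsomorphic_directSum_left α β).separable_iff,
      (orderIsomorphic_directSum_left α β).decomposable_iff,
      (orderIsomorphic_directSum_right α β).separable_iff, mem_indecomposables,
      mem_avoiders_iff]
    tauto
  refine sum_bij (fun p _ => directSum p.1 p.2) ?_ ?_ ?_ ?_
  · rintro ⟨α, β⟩ h
    exact (hmem α β).2 (mem_product.1 h)
  · rintro p _ q _ h
    exact directSum_injective h
  · intro π hπ
    obtain ⟨α, β, rfl⟩ := ((hs π).1 hπ).2.1.exists_directSum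
    exact ⟨(α, β), mem_product.2 ((hmem α β).1 hπ), rfl⟩
  · rintro ⟨α, β⟩ _
    rw [(isCut_directSum hk hl α β).weight_eq,
      (orderIsomorphic_directSum_left α β).weight_eq,
      (orderIsomorphic_directSum_right α β).weight_eq]

theorem totalDecomposable_eq (n : ℕ) :
    totalDecomposable U D n = ∑ p ∈ antidiagonal n,
      ((if p.1 = 1 then 1 else 0) + totalDecomposable D U p.1) * U * total U D p.2 := by
  classical
  -- The least cut; the default value 0 for an empty set never matters, as only decomposable `π` are
  -- used.
  let g : Perm (Fin n) → ℕ := fun π => sInf {k | IsCut n (seq π) k}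
  have hg : ∀ π ∈ decomposables n, IsCut n (seq π) (g π) :=
    fun π hπ => Nat.sInf_mem (mem_decomposables.1 hπ).2
  have hmaps : ∀ π ∈ decomposables n, (g π, n - g π) ∈ antidiagonal n := fun π hπ => by
    have := (hg π hπ).2.1
    rw [HasAntidiagonal.mem_antidiagonal]
    dsimp only
    omega
  rw [totalDecomposable, ← sum_fiberwise_of_maps_to hmaps]
  refine sum_congr rfl ?_
  rintro ⟨k, l⟩ hkl
  obtain rfl : k + l = n := HasAntidiagonal.mem_antidiagonal.1 hkl
  dsimp only
  rcases Nat.eq_zero_or_pos k with rfl | hk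
  · rw [if_neg zero_ne_one, totalDecomposable, decomposables_of_lt_two Nat.zero_lt_two, sum_empty,
      add_zero, zero_mul, zero_mul]
    refine sum_eq_zero fun π hπ => ?_
    obtain ⟨h1, h2⟩ := mem_filter.1 hπ
    have h3 := (hg π h1).1
    have h4 := (Prod.ext_iff.1 h2).1
    dsimp only at h4
    omega
  rcases Nat.eq_zero_or_pos l with rfl | hl
  -- The convention that `total` vanishes at length 0 removes the empty right block.
  · rw [total, if_pos rfl, mul_zero]
    refine sum_eq_zero fun π hπ => ?_
    obtain ⟨h1, h2⟩ := mem_filter.1 hπ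
    have h3 := (hg π h1).2.1
    have h4 := (Prod.ext_iff.1 h2).1
    dsimp only at h4
    omega
  refine sum_leastCut U D hk hl _ fun π => ?_
  rw [mem_filter, mem_decomposables, Prod.mk_inj]
  constructor
  · rintro ⟨⟨h1, h2⟩, h3, -⟩
    have hc := hg π (mem_decomposables.2 ⟨h1, h2⟩)
    rw [h3] at hc
    exact ⟨h1, hc, fun j hj => h3 ▸ Nat.sInf_le hj⟩
  · rintro ⟨h1, h2, h3⟩
    have hgk : g π = k := le_antisymm (Nat.sInf_le h2)
      (h3 _ (hg π (mem_decomposables.2 ⟨h1, k, h2⟩)))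
    exact ⟨⟨h1, k, h2⟩, hgk, by omega⟩

/-- Symmetry of `total` puts the same series P in both recursions, which closes the system in P, A,
B. -/
theorem totalDecomposable_swap_eq (n : ℕ) :
    totalDecomposable D U n = ∑ p ∈ antidiagonal n,
      ((if p.1 = 1 then 1 else 0) + totalDecomposable U D p.1) * D * total U D p.2 := by
  rw [totalDecomposable_eq]
  simp only [total_comm D U]

end

end PermPattern

namespace PermPattern

/-! ### Cubic equations for the generating series. -/

section

open PowerSeries

/-- A power series over a domain is determined by `f = z + z f² + f³` and its vanishing constant
term. -/
theorem powerSeries_eq_of_cubic {K : Type*} [CommRing K] [IsDomain K] {f g : PowerSeries K}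
    (hf0 : constantCoeff f = 0) (hg0 : constantCoeff g = 0)
    (hf : f = X + X * f ^ 2 + f ^ 3) (hg : g = X + X * g ^ 2 + g ^ 3) : f = g := by
  -- The second factor has constant term 1, hence is nonzero.
  have h : (f - g) * (1 - X * (f + g) - (f ^ 2 + f * g + g ^ 2)) = 0 := by
    linear_combination hf - hg
  refine sub_eq_zero.1 ((mul_eq_zero.1 h).resolve_right fun h0 => ?_)
  have := congrArg constantCoeff h0
  simp [hf0, hg0] at this

section Sign

/-- The signed enumerator of the avoiders. -/
theorem signed_cubic :
    let P : PowerSeries ℤ := PowerSeries.mk (total (1 : ℤ) (-1))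
    P = X - X * P ^ 2 - P ^ 3 := by
  intro P
  set A : PowerSeries ℤ := PowerSeries.mk (totalDecomposable (1 : ℤ) (-1)) with hA
  set B : PowerSeries ℤ := PowerSeries.mk (totalDecomposable (-1 : ℤ) 1) with hB
  have h1 : P = X + A + B := by
    ext n
    simp only [P, hA, hB, map_add, coeff_mk, coeff_X, total_eq (1 : ℤ) (-1) n]
  have h2 : A = (X + B) * P := by
    ext n
    simp only [P, hA, hB, coeff_mul, map_add, coeff_mk, coeff_X,
      totalDecomposable_eq (1 : ℤ) (-1) n, mul_one]
  have h3 : B = -((X + A) * P) := by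
    ext n
    simp only [P, hA, hB, coeff_mul, map_add, map_neg, coeff_mk, coeff_X,
      totalDecomposable_swap_eq (1 : ℤ) (-1) n, mul_neg, mul_one, neg_mul,
      Finset.sum_neg_distrib]
  -- Solving `h2`, `h3` linearly for A and B has determinant 1 + P².
  linear_combination (1 + P ^ 2) * h1 + (1 - P) * h2 + (1 + P) * h3

end Sign

section Alternating

/-- Elementary matrix recording an ascent at an even position. -/
def up : Matrix (Fin 2) (Fin 2) ℤ := !![0, 1; 0, 0]

/-- Elementary matrix recording a descent at an odd position. -/
def down : Matrix (Fin 2) (Fin 2) ℤ := !![0, 0; 1, 0]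

theorem mul_up_mul_apply (A B : Matrix (Fin 2) (Fin 2) ℤ) (i j : Fin 2) :
    (A * up * B) i j = A i 0 * B 1 j := by
  simp [Matrix.mul_apply, up, Fin.sum_univ_two]

theorem mul_down_mul_apply (A B : Matrix (Fin 2) (Fin 2) ℤ) (i j : Fin 2) :
    (A * down * B) i j = A i 1 * B 0 j := by
  simp [Matrix.mul_apply, down, Fin.sum_univ_two]

/-- The matrix system is solved entrywise: with x = X + B₀₀, the aim is P₀₀ = x(1 + P₀₀²) and x(1 -
P₀₀²) = X, from which x is eliminated. -/
theorem alternating_cubic :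
    let R : PowerSeries ℤ := PowerSeries.mk fun n => total up down n 0 0
    R = X + X * R ^ 2 + R ^ 3 := by
  intro R
  let P : Fin 2 → Fin 2 → PowerSeries ℤ := fun i j => PowerSeries.mk fun n => total up down n i j
  let A : Fin 2 → Fin 2 → PowerSeries ℤ :=
    fun i j => PowerSeries.mk fun n => totalDecomposable up down n i j
  let B : Fin 2 → Fin 2 → PowerSeries ℤ :=
    fun i j => PowerSeries.mk fun n => totalDecomposable down up n i j
  have hone : ∀ (n : ℕ) (i j : Fin 2), (if n = 1 then (1 : Matrix (Fin 2) (Fin 2) ℤ) else 0) i j =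
      coeff n (if i = j then X else 0 : PowerSeries ℤ) := by
    intro n i j
    by_cases hij : i = j <;> by_cases hn : n = 1 <;> simp [hij, hn, coeff_X, Matrix.one_apply]
  have h1 : ∀ i j, P i j = (if i = j then X else 0) + A i j + B i j := by
    intro i j
    ext n
    simp only [P, A, B, map_add, coeff_mk, total_eq up down n, Matrix.add_apply, hone]
  have h2 : ∀ i j, A i j = ((if i = 0 then X else 0) + B i 0) * P 1 j := by
    intro i j
    ext n
    simp only [P, A, B, coeff_mul, map_add, coeff_mk, totalDecomposable_eq up down n,
      Matrix.sum_apply, mul_up_mul_apply, Matrix.add_apply, hone]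
  have h3 : ∀ i j, B i j = ((if i = 1 then X else 0) + A i 1) * P 0 j := by
    intro i j
    ext n
    simp only [P, A, B, coeff_mul, map_add, coeff_mk, totalDecomposable_swap_eq up down n,
      Matrix.sum_apply, mul_down_mul_apply, Matrix.add_apply, hone]
  have hP0 : ∀ i j, constantCoeff (P i j) = 0 := by
    intro i j
    rw [← coeff_zero_eq_constantCoeff_apply, coeff_mk]
    simp [total]
  have p00 := h1 0 0
  have p01 := h1 0 1
  have p10 := h1 1 0
  have p11 := h1 1 1
  have a00 := h2 0 0
  have a01 := h2 0 1
  have a10 := h2 1 0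
  have a11 := h2 1 1
  have b00 := h3 0 0
  have b01 := h3 0 1
  have b10 := h3 1 0
  have b11 := h3 1 1
  simp only [if_true, zero_ne_one, one_ne_zero, if_false, zero_add] at *
  -- Both sides solve y = X + P₀₀P₁₁y, and 1 - P₀₀P₁₁ is nonzero.
  have hx : X + B 0 0 = X + A 1 1 := by
    have h : (X + B 0 0 - (X + A 1 1)) * (1 - P 0 0 * P 1 1) = 0 := by
      linear_combination b00 + P 0 0 * a01 - a11 - P 1 1 * b10
    refine sub_eq_zero.1 ((mul_eq_zero.1 h).resolve_right fun h0 => ?_)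
    have := congrArg constantCoeff h0
    simp [hP0] at this
  set x := X + B 0 0 with hxdef
  have e10 : P 1 0 = P 0 0 ^ 2 := by
    rw [← hx] at b10
    linear_combination p10 + a10 + (1 + P 1 0) * b10 - P 0 0 * p00 - P 0 0 * a00 - P 0 0 * hxdef
  have e01 : P 0 1 = P 1 1 ^ 2 := by
    rw [← hx] at b11
    linear_combination p01 + b01 + (1 + P 0 1) * a01 - P 1 1 * p11 - P 1 1 * b11 + P 1 1 * hx
  have q0 : P 0 0 = x * (1 + P 0 0 ^ 2) := by
    linear_combination p00 + a00 + hxdef + x * e10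
  have q1 : P 1 1 = x * (1 + P 1 1 ^ 2) := by
    rw [← hx] at b11
    linear_combination p11 + b11 - hx + x * e01
  have hx0 : constantCoeff x = 0 := by
    have := congrArg constantCoeff q0
    simpa [hP0] using this.symm
  -- Both solve p = x(1 + p²), which has a unique solution with zero constant term.
  have hsymm : P 0 0 = P 1 1 := by
    have h : (P 0 0 - P 1 1) * (1 - x * (P 0 0 + P 1 1)) = 0 := by
      linear_combination q0 - q1
    refine sub_eq_zero.1 ((mul_eq_zero.1 h).resolve_right fun h0 => ?_)
    have := congrArg constantCoeff h0
    simp [hP0] at this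
  rw [← hsymm] at a01
  have hxX : x * (1 - P 0 0 ^ 2) = X := by
    linear_combination hxdef + b00 + P 0 0 * a01
  change P 0 0 = X + X * P 0 0 ^ 2 + P 0 0 ^ 3
  linear_combination (1 - P 0 0 ^ 2) * q0 + (1 + P 0 0 ^ 2) * hxX

end Alternating

end

end PermPattern

namespace PermPattern

/-! ### Reading off descents and alternation from the weights; comparison of the two series. -/

section

open Equiv

theorem card_filter_range_succ (p : ℕ → Prop) [DecidablePred p] (m : ℕ) :
    ((Finset.range (m + 1)).filter p).card =
      ((Finset.range m).filter p).card + if p m then 1 else 0 := by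
  rw [Finset.range_add_one, Finset.filter_insert]
  split_ifs
  · rw [Finset.card_insert_of_notMem (by simp)]
  · rfl

theorem des_eq {n : ℕ} (π : Perm (Fin n)) :
    des π = ((Finset.range (n - 1)).filter fun i => ¬ seq π i < seq π (i + 1)).card := by
  unfold des
  refine Finset.card_bij (fun i _ => (i : ℕ)) ?_ (fun _ _ _ _ h => Fin.ext h) ?_
  · rintro i hi
    obtain ⟨j, hj, hlt⟩ := (Finset.mem_filter.1 hi).2
    rw [Finset.mem_filter, Finset.mem_range, ← hj, seq_val, seq_val]
    exact ⟨by omega, not_lt.2 (Fin.le_def.1 hlt.le)⟩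
  · intro i hi
    rw [Finset.mem_filter, Finset.mem_range] at hi
    obtain ⟨h1, h2⟩ := hi
    refine ⟨⟨i, by omega⟩, ?_, rfl⟩
    rw [Finset.mem_filter]
    refine ⟨Finset.mem_univ _, ⟨i + 1, by omega⟩, rfl, ?_⟩
    rw [seq_of_lt _ (by omega), seq_of_lt _ (by omega), ← Fin.lt_def, not_lt] at h2
    refine lt_of_le_of_ne h2 fun h => ?_
    have := congrArg Fin.val (π.injective h)
    simp at this

theorem weight_sign {n : ℕ} (π : Perm (Fin n)) :
    weight (1 : ℤ) (-1) n (seq π) = (-1) ^ des π := by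
  rw [des_eq, weight]
  induction n - 1 with
  | zero => simp
  | succ m ih =>
    rw [List.range_succ, List.map_append, List.prod_append, ih, card_filter_range_succ, pow_add]
    congr 1
    by_cases h : seq π m < seq π (m + 1) <;> simp [h]

theorem isAlternating_iff {n : ℕ} (π : Perm (Fin n)) :
    IsAlternating π ↔ ∀ i, i < n - 1 → (seq π i < seq π (i + 1) ↔ Even i) := by
  constructor
  · intro h i hi
    have := h ⟨i, by omega⟩ ⟨i + 1, by omega⟩ rfl
    rw [seq_of_lt _ (by omega), seq_of_lt _ (by omega), ← Fin.lt_def]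
    refine ⟨fun h1 => ?_, this.1⟩
    by_contra h2
    exact h1.not_gt (this.2 (Nat.not_even_iff_odd.1 h2))
  · intro h i j hij
    have h1 := h i (by omega)
    rw [← hij, seq_val, seq_val, ← Fin.lt_def] at h1
    refine ⟨h1.2, fun ho => lt_of_le_of_ne (not_lt.1 (mt h1.1 (Nat.not_even_iff_odd.2 ho))) ?_⟩
    intro he
    have := congrArg Fin.val (π.injective he)
    omega

/-- A product of matrix units survives in row 0 only if `up` and `down` alternate starting with
`up`; the column is then the parity of `m`. The induction needs both columns. -/
theorem prod_up_down_apply (p : ℕ → Prop) [DecidablePred p] (m : ℕ) :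
    ((List.range m).map fun i => if p i then up else down).prod 0 0 =
        (if Even m ∧ ∀ i, i < m → (p i ↔ Even i) then 1 else 0) ∧
      ((List.range m).map fun i => if p i then up else down).prod 0 1 =
        (if ¬ Even m ∧ ∀ i, i < m → (p i ↔ Even i) then 1 else 0) := by
  classical
  induction m with
  | zero => simp
  | succ m ih =>
    rw [List.range_succ, List.map_append, List.prod_append, List.map_singleton,
      List.prod_singleton]
    have hall : (∀ i, i < m + 1 → (p i ↔ Even i)) ↔
        (∀ i, i < m → (p i ↔ Even i)) ∧ (p m ↔ Even m) := Nat.forall_lt_succ_right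
    simp only [Matrix.mul_apply, Fin.sum_univ_two, ih.1, ih.2, hall, Nat.even_add_one]
    by_cases h : p m <;> by_cases he : Even m <;>
      by_cases ha : ∀ i, i < m → (p i ↔ Even i) <;> simp [h, he, ha, up, down]

theorem total_up_down (m : ℕ) : total up down (2 * m + 1) 0 0 = r m := by
  rw [total, if_neg (by omega), Matrix.sum_apply, r, alternatingAvoiders, Finset.card_filter,
    Nat.cast_sum]
  refine Finset.sum_congr rfl fun π _ => ?_
  rw [weight, (prod_up_down_apply _ _).1]
  simp [isAlternating_iff]

theorem total_sign {n : ℕ} (hn : n ≠ 0) :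
    total (1 : ℤ) (-1) n = ∑ π ∈ avoiders n, (-1 : ℤ) ^ des π := by
  rw [total, if_neg hn]
  exact Finset.sum_congr rfl fun π _ => weight_sign π

open PowerSeries in
-- Coefficientwise form of P(iX) = iR: the series -i P(iX) satisfies the cubic of R.
theorem I_pow_mul_total_sign (n : ℕ) :
    Complex.I ^ n * ((total (1 : ℤ) (-1) n : ℤ) : ℂ) = Complex.I * ((total up down n 0 0 : ℤ) : ℂ) := by
  set P : PowerSeries ℤ := PowerSeries.mk (total (1 : ℤ) (-1)) with hP
  set R : PowerSeries ℤ := PowerSeries.mk fun n => total up down n 0 0 with hR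
  let f : PowerSeries ℤ →+* PowerSeries ℂ :=
    (rescale Complex.I).comp (PowerSeries.map (Int.castRingHom ℂ))
  let g : PowerSeries ℤ →+* PowerSeries ℂ := PowerSeries.map (Int.castRingHom ℂ)
  have hfX : f X = C Complex.I * X := by
    simp [f, rescale_X]
  have hgX : g X = X := by simp [g]
  have hI : (C Complex.I : PowerSeries ℂ) ^ 2 = -1 := by
    rw [← map_pow, Complex.I_sq, map_neg, map_one]
  have hPf : f P = C Complex.I * X - C Complex.I * X * f P ^ 2 - f P ^ 3 := by
    conv_lhs => rw [show P = _ from signed_cubic]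
    rw [map_sub, map_sub, map_mul, map_pow, map_pow, hfX]
  have hRg : g R = X + X * g R ^ 2 + g R ^ 3 := by
    conv_lhs => rw [show R = _ from alternating_cubic]
    rw [map_add, map_add, map_mul, map_pow, map_pow, hgX]
  have h : -C Complex.I * f P = g R := by
    refine powerSeries_eq_of_cubic ?_ ?_ ?_ hRg
    · rw [map_mul, ← coeff_zero_eq_constantCoeff_apply (f P)]
      simp only [f, P, RingHom.comp_apply, coeff_rescale, coeff_map, coeff_mk]
      simp [total]
    · rw [← coeff_zero_eq_constantCoeff_apply]
      simp only [g, R, coeff_map, coeff_mk]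
      simp [total]
    · linear_combination (-C Complex.I) * hPf +
        (-X + C Complex.I * f P ^ 3) * hI
  have hc := congrArg (coeff n) h
  rw [← map_neg, coeff_C_mul] at hc
  simp only [f, g, RingHom.comp_apply, coeff_rescale, coeff_map, hP, hR, coeff_mk,
    eq_intCast] at hc
  rw [← hc]
  linear_combination (Complex.I ^ n * ((total (1 : ℤ) (-1) n : ℤ) : ℂ)) * Complex.I_sq

end

end PermPattern

theorem mainTheorem10 (n : ℕ) (hn : 1 ≤ n) :
    (PermPattern.S n).eval (-1) =
        ∑ π ∈ PermPattern.avoiders n, (-1 : ℤ) ^ PermPattern.des π ∧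
      ∑ π ∈ PermPattern.avoiders n, (-1 : ℤ) ^ PermPattern.des π =
        if Even n then 0 else (-1) ^ ((n - 1) / 2) * (PermPattern.r ((n - 1) / 2) : ℤ) := by
  refine ⟨by simp [PermPattern.S, Polynomial.eval_finsetSum], ?_⟩
  rw [← PermPattern.total_sign (by omega)]
  have h := PermPattern.I_pow_mul_total_sign n
  split_ifs with he
  · obtain ⟨m, rfl⟩ := he
    rw [← two_mul, pow_mul, Complex.I_sq] at h
    -- For even `n` the left side is real and the right side purely imaginary, so real parts show
    -- that the signed total is 0.
    have hre := congrArg Complex.re h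
    rcases neg_one_pow_eq_or ℂ m with h1 | h1
    · rw [h1] at hre
      rw [← two_mul]
      simpa using hre
    · rw [h1] at hre
      rw [← two_mul]
      simpa using hre
  · obtain ⟨m, rfl⟩ := Nat.not_even_iff_odd.1 he
    rw [show (2 * m + 1 - 1) / 2 = m by omega, ← PermPattern.total_up_down]
    rw [pow_succ, pow_mul, Complex.I_sq, mul_comm _ Complex.I, mul_assoc] at h
    have h' := mul_left_cancel₀ Complex.I_ne_zero h
    have h2 : (-1 : ℤ) ^ m * PermPattern.total (1 : ℤ) (-1) (2 * m + 1) =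
        PermPattern.total PermPattern.up PermPattern.down (2 * m + 1) 0 0 := by
      exact_mod_cast h'
    rw [← h2, ← mul_assoc, ← mul_pow]
    simp
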